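/- Let $K\ge 2$ be an integer and let $A,B,\tau>0$ satisfy $KA\le B<1$ and $\tau\le (1-B)/K$. Let $\{S_1(u),\dots,S_K(u)\}_{u\in\mathcal A}$ be a family of iterated function systems, each consisting of $K$ similarities of $[0,1]$ into itself, where $S_i(u)$ has scaling ratio $a(i,u)$. Suppose that $a(i,u)\ge A$ for all $i,u$, that $\sum_{i=1}^K a(i,u)\le B$ for all $u$, and that $\operatorname{dist}(S_i(u)[0,1],S_j(u)[0,1])\ge\tau$ for all $i\ne j$ and all $u$. Let $\mathcal Q$ be a probability measure on $\mathcal A$ for which the ratios $a(i,\cdot)$ are measurable. Call $p=(p(1),\dots,p(K))$ a valid single probability if $p(i)>0$ for all $i$ and $\sum_{i=1}^K p(i)=1$. For such $p$, for $\theta\ge 0$ and $u\in\mathcal A$, let $m'_p(\theta,u)$ be the minimal index $m\in\{1,\dots,K\}$ with $$\frac{a(m,u)^\theta}{p(m)}=\min_{1\le j\le K}\frac{a(j,u)^\theta}{p(j)},$$ and put $$G'_p(\theta)=\frac{\mathbb E_{u\sim\mathcal Q}\big[\log p(m'_p(\theta,u))\big]}{\mathbb E_{u\sim\mathcal Q}\big[\log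 a(m'_p(\theta,u),u)\big]},\qquad M'(p)=\inf_{\theta\ge 0}G'_p(\theta).$$ Then there exists a valid single probability $q$ such that $M'(q)=\sup_p M'(p)$, where the supremum is taken over all valid single probabilities $p$. -/

import Mathlib

open MeasureTheory

/-- A family, indexed by a measurable space `𝒜`, of uniformly strongly separated iterated function
systems on `[0,1]`, each made of `K` similarities `S u 0, …, S u (K-1)`; `a i u` is the scaling
ratio of `S u i`. -/
structure SeparatedIFSFamily (K : ℕ) (𝒜 : Type*) [MeasurableSpace 𝒜] where
  A : ℝ
  B : ℝ
  τ : ℝ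
  A_pos : 0 < A
  τ_pos : 0 < τ
  K_mul_A_le : K * A ≤ B
  B_lt_one : B < 1
  τ_le : τ ≤ (1 - B) / K
  S : 𝒜 → Fin K → ℝ → ℝ
  a : Fin K → 𝒜 → ℝ
  mapsTo : ∀ u i, Set.MapsTo (S u i) (Set.Icc 0 1) (Set.Icc 0 1)
  similarity : ∀ u i, ∀ x ∈ Set.Icc (0 : ℝ) 1, ∀ y ∈ Set.Icc (0 : ℝ) 1,
    |S u i x - S u i y| = a i u * |x - y|
  A_le : ∀ i u, A ≤ a i u
  sum_le : ∀ u, ∑ i, a i u ≤ B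
  separated : ∀ u i j, i ≠ j → ∀ x ∈ Set.Icc (0 : ℝ) 1, ∀ y ∈ Set.Icc (0 : ℝ) 1,
    τ ≤ |S u i x - S u j y|
  measurable_a : ∀ i, Measurable (a i)

theorem exists_minimizer {K : ℕ} [NeZero K] (f : Fin K → ℝ) :
    (Finset.univ.filter (fun i => ∀ j, f i ≤ f j)).Nonempty := by
  obtain ⟨i, -, hi⟩ := Finset.exists_min_image Finset.univ f ⟨0, Finset.mem_univ _⟩
  exact ⟨i, by simpa using hi⟩

/-- The minimal index at which `f` attains its minimum. -/
noncomputable def minIndex {K : ℕ} [NeZero K] (f : Fin K → ℝ) : Fin K :=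
  (Finset.univ.filter (fun i => ∀ j, f i ≤ f j)).min' (exists_minimizer f)

/-- The valid single probability weight vectors: strictly positive weights with sum `1`. -/
def validWeights (K : ℕ) : Set (Fin K → ℝ) :=
  {p | (∀ i, 0 < p i) ∧ ∑ i, p i = 1}

namespace SeparatedIFSFamily

variable {K : ℕ} [NeZero K] {𝒜 : Type*} [MeasurableSpace 𝒜]

/-- The index `m'(θ, λ)`, for `λ = (u, v)` a pair of an IFS index and a weight vector: the minimal
index that minimizes `a(j, u) ^ θ / v(j)`. -/
noncomputable def mPrime (F : SeparatedIFSFamily K 𝒜) (θ : ℝ) (l : 𝒜 × (Fin K → ℝ)) : Fin K :=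
  minIndex (fun j => F.a j l.1 ^ θ / l.2 j)

/-- `G'(θ) = 𝔼[log p(m')] / 𝔼[log a(m')]`, the expectations being taken with respect to a measure
`P` on the space of pairs of an IFS index and a weight vector. -/
noncomputable def GPrime (F : SeparatedIFSFamily K 𝒜) (P : Measure (𝒜 × (Fin K → ℝ)))
    (θ : ℝ) : ℝ :=
  (∫ l, Real.log (l.2 (F.mPrime θ l)) ∂P) / (∫ l, Real.log (F.a (F.mPrime θ l) l.1) ∂P)

/-- `M'(p) = inf_{θ ≥ 0} G'_p(θ)`: here the IFS index has law `Q` and, independently, the weight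
vector is deterministic and equal to `p`. -/
noncomputable def MPrime (F : SeparatedIFSFamily K 𝒜) (Q : Measure 𝒜) (p : Fin K → ℝ) : ℝ :=
  ⨅ θ : Set.Ici (0 : ℝ), F.GPrime (Q.prod (Measure.dirac p)) θ

end SeparatedIFSFamily

/-!
Write `Φ_p(t) = 𝔼 min_j (t log a(j,u) - log p(j))`. At `t = θ` the minimum is attained at the index
`m'_p(θ,u)`, and for other `t` the value at that index still bounds the minimum from above. So
`t ↦ t 𝔼[log a(m')] - 𝔼[log p(m')]` is a line which lies above the concave function `Φ_p` and touches
it at `θ`; `G'_p(θ)` is the zero of this decreasing line. Hence, for `t ≥ 0`,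
`t ≤ M'(p)` if and only if `0 ≤ Φ_p(t)` (`le_MPrime_iff`): `M'(p)` is the zero of `Φ_p`.

Since `p` has mass `1` and the ratios have sum at most `B < 1`, this zero lies in `[0,1]`. Weights
below `ε = A / K` are never selected for `t ∈ [0,1]`, so raising them to `ε`, at the expense of a
weight that is at least `1 / K`, does not decrease `Φ_p(t)` (`exists_floorWeights`, `logCost_mono_of_le_max`). It
therefore suffices to maximize `t` over the pairs `(p,t)` with `p ≥ ε`, `t ∈ [0,1]` and
`0 ≤ Φ_p(t)`. These form a compact set, because `Φ` is jointly continuous there by dominated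
convergence (`continuousOn_meanCost`).
-/

/-! ### The minimal minimizing index -/

theorem minIndex_le {K : ℕ} [NeZero K] (f : Fin K → ℝ) (j : Fin K) : f (minIndex f) ≤ f j :=
  (Finset.mem_filter.1 (Finset.min'_mem _ (exists_minimizer f))).2 j

theorem minIndex_eq_iff {K : ℕ} [NeZero K] (f : Fin K → ℝ) (i : Fin K) :
    minIndex f = i ↔ (∀ j, f i ≤ f j) ∧ ∀ k, (∀ j, f k ≤ f j) → i ≤ k := by
  constructor
  · rintro rfl
    exact ⟨minIndex_le f, fun k hk ↦ Finset.min'_le _ _ (by simpa using hk)⟩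
  · rintro ⟨h1, h2⟩
    exact le_antisymm (Finset.min'_le _ _ (by simpa using h1)) (h2 _ (minIndex_le f))

theorem measurable_minIndex {K : ℕ} [NeZero K] :
    Measurable (minIndex : (Fin K → ℝ) → Fin K) := by
  refine measurable_to_countable' fun i ↦ ?_
  have hm (k : Fin K) : MeasurableSet {f : Fin K → ℝ | ∀ j, f k ≤ f j} := by
    simp only [Set.ofPred_forall]
    exact MeasurableSet.iInter fun j ↦
      measurableSet_le (measurable_pi_apply k) (measurable_pi_apply j)
  have : minIndex ⁻¹' {i} = {f : Fin K → ℝ | ∀ j, f i ≤ f j} ∩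
      ⋂ k, ({f : Fin K → ℝ | ∀ j, f k ≤ f j}ᶜ ∪ {_f | i ≤ k}) := by
    ext f
    simp only [Set.mem_preimage, Set.mem_singleton_iff, minIndex_eq_iff, Set.mem_inter_iff,
      Set.mem_iInter, Set.mem_union, Set.mem_compl_iff, Set.mem_ofPred_eq, imp_iff_not_or]
  rw [this]
  exact (hm i).inter (MeasurableSet.iInter fun k ↦ (hm k).compl.union (MeasurableSet.const _))

theorem validWeights.le_one {K : ℕ} {p : Fin K → ℝ} (hp : p ∈ validWeights K) (i : Fin K) :
    p i ≤ 1 :=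
  hp.2 ▸ Finset.single_le_sum (fun j _ ↦ (hp.1 j).le) (Finset.mem_univ i)

/-- Every weight vector can be modified, without raising any weight above `max (p j) ε`, so that all
its weights are at least `ε`: weights below `ε` are raised to `ε`, and a weight `p k ≥ 1 / K` pays
for this. -/
theorem exists_floorWeights {K : ℕ} [NeZero K] {p : Fin K → ℝ} (hp : p ∈ validWeights K) {ε : ℝ}
    (hε : 0 < ε) (hεK : K * ε ≤ 1 / K) :
    ∃ q : Fin K → ℝ, (∀ j, ε ≤ q j) ∧ ∑ j, q j = 1 ∧ (∀ j, q j ≤ max (p j) ε) ∧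
      ∃ k, 1 / (K : ℝ) ≤ p k := by
  have hK : (0 : ℝ) < K := by exact_mod_cast Nat.pos_of_ne_zero (NeZero.ne K)
  obtain ⟨k, hk⟩ : ∃ k, 1 / (K : ℝ) ≤ p k := by
    by_contra! h
    have : ∑ i, p i < ∑ _i : Fin K, 1 / (K : ℝ) :=
      Finset.sum_lt_sum_of_nonempty ⟨0, Finset.mem_univ _⟩ fun i _ ↦ h i
    rw [hp.2, Finset.sum_const, Finset.card_univ, Fintype.card_fin, nsmul_eq_mul,
      mul_one_div_cancel hK.ne'] at this
    exact this.false
  have hsplit (g : Fin K → ℝ) : ∑ i, g i = g k + ∑ i ∈ Finset.univ.erase k, g i :=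
    (Finset.add_sum_erase _ _ (Finset.mem_univ k)).symm
  set s := ∑ i ∈ Finset.univ.erase k, max (p i) ε with hs
  have h1 : ∑ i ∈ Finset.univ.erase k, p i ≤ s := Finset.sum_le_sum fun i _ ↦ le_max_left _ _
  have h2 : s ≤ ∑ i ∈ Finset.univ.erase k, (p i + ε) := by
    refine Finset.sum_le_sum fun i _ ↦ ?_
    rcases max_cases (p i) ε with h | h <;> linarith [hp.1 i]
  have h3 := hsplit p
  have h4 := hsplit fun i ↦ p i + ε
  have h5 : ∑ i, (p i + ε) = 1 + K * ε := by
    rw [Finset.sum_add_distrib, hp.2]; simp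
  rw [hp.2] at h3
  refine ⟨Function.update (fun i ↦ max (p i) ε) k (1 - s), fun j ↦ ?_, ?_, fun j ↦ ?_, k, hk⟩
  · rcases eq_or_ne j k with rfl | hj
    · rw [Function.update_self]; linarith
    · rw [Function.update_of_ne hj]; exact le_max_right _ _
  · rw [hsplit, Function.update_self, Finset.sum_congr rfl fun i hi ↦
      Function.update_of_ne (Finset.ne_of_mem_erase hi) _ _]
    linarith
  · rcases eq_or_ne j k with rfl | hj
    · rw [Function.update_self]; exact le_max_of_le_left (by linarith)
    · rw [Function.update_of_ne hj]

namespace SeparatedIFSFamily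

variable {K : ℕ} {𝒜 : Type*} [MeasurableSpace 𝒜]

/-! ### Bounds on the ratios -/

theorem a_pos (F : SeparatedIFSFamily K 𝒜) (i : Fin K) (u : 𝒜) : 0 < F.a i u :=
  F.A_pos.trans_le (F.A_le i u)

theorem le_log_a (F : SeparatedIFSFamily K 𝒜) (i : Fin K) (u : 𝒜) :
    Real.log F.A ≤ Real.log (F.a i u) :=
  Real.log_le_log F.A_pos (F.A_le i u)

theorem a_le_B (F : SeparatedIFSFamily K 𝒜) (i : Fin K) (u : 𝒜) : F.a i u ≤ F.B :=
  (Finset.single_le_sum (fun j _ ↦ (F.a_pos j u).le) (Finset.mem_univ i)).trans (F.sum_le u)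

theorem log_a_le (F : SeparatedIFSFamily K 𝒜) (i : Fin K) (u : 𝒜) :
    Real.log (F.a i u) ≤ Real.log F.B :=
  Real.log_le_log (F.a_pos i u) (F.a_le_B i u)

variable [NeZero K]

theorem B_pos (F : SeparatedIFSFamily K 𝒜) : 0 < F.B :=
  (mul_pos (by exact_mod_cast Nat.pos_of_ne_zero (NeZero.ne K)) F.A_pos).trans_le F.K_mul_A_le

theorem log_B_neg (F : SeparatedIFSFamily K 𝒜) : Real.log F.B < 0 :=
  Real.log_neg F.B_pos F.B_lt_one

theorem log_a_neg (F : SeparatedIFSFamily K 𝒜) (i : Fin K) (u : 𝒜) : Real.log (F.a i u) < 0 :=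
  (F.log_a_le i u).trans_lt F.log_B_neg

theorem abs_log_a_le (F : SeparatedIFSFamily K 𝒜) (i : Fin K) (u : 𝒜) :
    |Real.log (F.a i u)| ≤ |Real.log F.A| := by
  rw [abs_of_neg (F.log_a_neg i u), abs_of_neg ((F.le_log_a i u).trans_lt (F.log_a_neg i u))]
  linarith [F.le_log_a i u]

theorem abs_mul_log_sub_log_le (F : SeparatedIFSFamily K 𝒜) {p : Fin K → ℝ} {t ε : ℝ}
    (hε : 0 < ε) (hp : ∀ i, ε ≤ p i) (hp1 : ∀ i, p i ≤ 1) (i : Fin K) (u : 𝒜) :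
    |t * Real.log (F.a i u) - Real.log (p i)| ≤ |t| * |Real.log F.A| + |Real.log ε| := by
  refine (abs_sub _ _).trans (add_le_add ?_ ?_)
  · rw [abs_mul]
    exact mul_le_mul_of_nonneg_left (F.abs_log_a_le i u) (abs_nonneg t)
  · have h1 := Real.log_le_log hε (hp i)
    have h2 := Real.log_nonpos (hε.le.trans (hp i)) (hp1 i)
    rw [abs_of_nonpos h2, abs_of_nonpos (h1.trans h2)]
    linarith

/-! ### The expected minimal logarithmic cost -/

/-- The minimum over `j` of `log (a(j,u) ^ t / p(j)) = t log a(j,u) - log p(j)`. -/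
noncomputable def logCost (F : SeparatedIFSFamily K 𝒜) (p : Fin K → ℝ) (t : ℝ) (u : 𝒜) : ℝ :=
  Finset.univ.inf' ⟨0, Finset.mem_univ _⟩ fun j ↦ t * Real.log (F.a j u) - Real.log (p j)

/-- The expectation of `logCost` when the IFS index has law `Q`. -/
noncomputable def meanCost (F : SeparatedIFSFamily K 𝒜) (Q : Measure 𝒜) (p : Fin K → ℝ)
    (t : ℝ) : ℝ :=
  ∫ u, F.logCost p t u ∂Q

theorem logCost_le (F : SeparatedIFSFamily K 𝒜) (p : Fin K → ℝ) (t : ℝ) (u : 𝒜) (j : Fin K) :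
    F.logCost p t u ≤ t * Real.log (F.a j u) - Real.log (p j) :=
  Finset.inf'_le _ (Finset.mem_univ j)

theorem le_logCost_iff (F : SeparatedIFSFamily K 𝒜) {p : Fin K → ℝ} {t : ℝ} {u : 𝒜} {c : ℝ} :
    c ≤ F.logCost p t u ↔ ∀ j, c ≤ t * Real.log (F.a j u) - Real.log (p j) :=
  (Finset.le_inf'_iff _ _).trans (by simp only [Finset.mem_univ, true_imp_iff])

theorem logCost_eq_mPrime (F : SeparatedIFSFamily K 𝒜) {p : Fin K → ℝ} (hp : ∀ i, 0 < p i) (t : ℝ)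
    (u : 𝒜) : F.logCost p t u =
      t * Real.log (F.a (F.mPrime t (u, p)) u) - Real.log (p (F.mPrime t (u, p))) := by
  refine le_antisymm (F.logCost_le p t u _) (F.le_logCost_iff.2 fun j ↦ ?_)
  have hlog (i : Fin K) :
      t * Real.log (F.a i u) - Real.log (p i) = Real.log (F.a i u ^ t / p i) := by
    rw [Real.log_div (Real.rpow_pos_of_pos (F.a_pos i u) t).ne' (hp i).ne',
      Real.log_rpow (F.a_pos i u)]
  rw [hlog, hlog]
  exact Real.log_le_log (div_pos (Real.rpow_pos_of_pos (F.a_pos _ u) t) (hp _))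
    (minIndex_le (fun j ↦ F.a j u ^ t / p j) j)

theorem measurable_logCost (F : SeparatedIFSFamily K 𝒜) (p : Fin K → ℝ) (t : ℝ) :
    Measurable (F.logCost p t) := by
  have hinf : Continuous fun f : Fin K → ℝ ↦ Finset.univ.inf' ⟨0, Finset.mem_univ _⟩ f :=
    Continuous.finset_inf'_apply _ fun j _ ↦ continuous_apply j
  exact hinf.measurable.comp <| measurable_pi_lambda _ fun j ↦
    ((F.measurable_a j).log.const_mul t).sub_const _

theorem abs_logCost_le (F : SeparatedIFSFamily K 𝒜) {p : Fin K → ℝ} {t ε : ℝ}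
    (hε : 0 < ε) (hp : ∀ i, ε ≤ p i) (hp1 : ∀ i, p i ≤ 1) (u : 𝒜) :
    |F.logCost p t u| ≤ |t| * |Real.log F.A| + |Real.log ε| := by
  rw [F.logCost_eq_mPrime (fun i ↦ hε.trans_le (hp i))]
  exact F.abs_mul_log_sub_log_le hε hp hp1 _ u

theorem exists_pos_le {p : Fin K → ℝ} (hp : ∀ i, 0 < p i) : ∃ ε, 0 < ε ∧ ∀ i, ε ≤ p i :=
  ⟨p (minIndex p), hp _, minIndex_le p⟩

theorem integrable_logCost (F : SeparatedIFSFamily K 𝒜) (Q : Measure 𝒜) [IsProbabilityMeasure Q]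
    {p : Fin K → ℝ} (hp : p ∈ validWeights K) (t : ℝ) : Integrable (F.logCost p t) Q := by
  obtain ⟨ε, hε, hεp⟩ := exists_pos_le hp.1
  exact .of_bound (F.measurable_logCost p t).aestronglyMeasurable _
    (.of_forall fun u ↦ F.abs_logCost_le hε hεp (validWeights.le_one hp) u)

/-- Below `ε = A / K` a weight is never selected when `t ∈ [0,1]`, because some weight is at least
`1 / K`; so raising weights up to `ε` does not decrease the cost. -/
theorem logCost_mono_of_le_max (F : SeparatedIFSFamily K 𝒜) {p q : Fin K → ℝ} {t : ℝ}
    (ht : t ∈ Set.Icc (0 : ℝ) 1) (hq : ∀ j, 0 < q j) {k : Fin K} (hk : 1 / (K : ℝ) ≤ p k)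
    (hqp : ∀ j, q j ≤ max (p j) (F.A / K)) (u : 𝒜) : F.logCost p t u ≤ F.logCost q t u := by
  have hK : (0 : ℝ) < K := by exact_mod_cast Nat.pos_of_ne_zero (NeZero.ne K)
  refine F.le_logCost_iff.2 fun j ↦ ?_
  rcases le_max_iff.1 (hqp j) with h | h
  · have := Real.log_le_log (hq j) h
    linarith [F.logCost_le p t u j]
  · have h1 := Real.log_le_log (hq j) h
    rw [Real.log_div F.A_pos.ne' hK.ne'] at h1
    have h2 := Real.log_le_log (by positivity) hk
    rw [one_div, Real.log_inv] at h2
    have h3 : t * Real.log (F.a k u) ≤ 0 :=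
      mul_nonpos_of_nonneg_of_nonpos ht.1 (F.log_a_neg k u).le
    have h4 : 1 * Real.log (F.a j u) ≤ t * Real.log (F.a j u) :=
      mul_le_mul_of_nonpos_right ht.2 (F.log_a_neg j u).le
    linarith [F.logCost_le p t u k, F.le_log_a j u]

theorem meanCost_one_neg (F : SeparatedIFSFamily K 𝒜) (Q : Measure 𝒜) [IsProbabilityMeasure Q]
    {p : Fin K → ℝ} (hp : p ∈ validWeights K) : F.meanCost Q p 1 < 0 := by
  have h (u : 𝒜) : F.logCost p 1 u ≤ Real.log F.B := by
    by_contra! hlt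
    -- If every `a(j,u) / p(j)` exceeded `B`, then so would the sum of the ratios.
    have : ∑ j, F.B * p j < ∑ j, F.a j u := by
      refine Finset.sum_lt_sum_of_nonempty ⟨0, Finset.mem_univ _⟩ fun j _ ↦ ?_
      refine (Real.log_lt_log_iff (mul_pos F.B_pos (hp.1 j)) (F.a_pos j u)).1 ?_
      rw [Real.log_mul F.B_pos.ne' (hp.1 j).ne']
      linarith [F.logCost_le p 1 u j]
    rw [← Finset.mul_sum, hp.2, mul_one] at this
    exact (this.trans_le (F.sum_le u)).false
  calc F.meanCost Q p 1 ≤ ∫ _u, Real.log F.B ∂Q :=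
        integral_mono (F.integrable_logCost Q hp 1) (integrable_const _) h
    _ = Real.log F.B := by simp
    _ < 0 := F.log_B_neg

theorem meanCost_zero_nonneg (F : SeparatedIFSFamily K 𝒜) (Q : Measure 𝒜) {p : Fin K → ℝ}
    (hp : p ∈ validWeights K) : 0 ≤ F.meanCost Q p 0 :=
  integral_nonneg fun _ ↦ F.le_logCost_iff.2 fun j ↦ by
    simpa using Real.log_nonpos (hp.1 j).le (validWeights.le_one hp j)

theorem continuousOn_meanCost (F : SeparatedIFSFamily K 𝒜) (Q : Measure 𝒜)
    [IsProbabilityMeasure Q] {ε : ℝ} (hε : 0 < ε) :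
    ContinuousOn (fun x : (Fin K → ℝ) × ℝ ↦ F.meanCost Q x.1 x.2)
      (Set.Icc (fun _ ↦ ε) (fun _ ↦ 1) ×ˢ Set.Icc 0 1) := by
  refine continuousOn_of_dominated (bound := fun _ ↦ |Real.log F.A| + |Real.log ε|)
    (fun x _ ↦ (F.measurable_logCost _ _).aestronglyMeasurable)
    (fun x hx ↦ .of_forall fun u ↦ ?_) (integrable_const _) (.of_forall fun u ↦ ?_)
  · refine (F.abs_logCost_le hε hx.1.1 hx.1.2 u).trans (add_le_add_left ?_ _)
    exact mul_le_of_le_one_left (abs_nonneg _) (abs_le.2 ⟨by linarith [hx.2.1], hx.2.2⟩)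
  · refine ContinuousOn.finset_inf'_apply _ fun j _ ↦ ?_
    refine (continuousOn_snd.mul continuousOn_const).sub (ContinuousOn.log ?_ fun x hx ↦ ?_)
    · exact ((continuous_apply j).comp continuous_fst).continuousOn
    · exact (hε.trans_le (hx.1.1 j)).ne'

/-! ### The infimum `M'(p)` as the zero of the expected cost -/

theorem measurable_mPrime (F : SeparatedIFSFamily K 𝒜) (θ : ℝ) : Measurable (F.mPrime θ) :=
  measurable_minIndex.comp <| measurable_pi_lambda _ fun j ↦
    (((F.measurable_a j).comp measurable_fst).pow_const θ).div
      ((measurable_pi_apply j).comp measurable_snd)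

theorem measurable_apply_mPrime (F : SeparatedIFSFamily K 𝒜) (θ : ℝ)
    {g : Fin K → 𝒜 × (Fin K → ℝ) → ℝ} (hg : ∀ i, Measurable (g i)) :
    Measurable fun l ↦ g (F.mPrime θ l) l :=
  (measurable_from_prod_countable_right (f := fun x : Fin K × _ ↦ g x.1 x.2) hg).comp
    ((F.measurable_mPrime θ).prodMk measurable_id)

theorem measurable_log_a_mPrime (F : SeparatedIFSFamily K 𝒜) (θ : ℝ) :
    Measurable fun l : 𝒜 × (Fin K → ℝ) ↦ Real.log (F.a (F.mPrime θ l) l.1) :=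
  F.measurable_apply_mPrime θ (g := fun i l ↦ Real.log (F.a i l.1))
    fun i ↦ ((F.measurable_a i).comp measurable_fst).log

theorem measurable_log_weight_mPrime (F : SeparatedIFSFamily K 𝒜) (θ : ℝ) :
    Measurable fun l : 𝒜 × (Fin K → ℝ) ↦ Real.log (l.2 (F.mPrime θ l)) :=
  F.measurable_apply_mPrime θ (g := fun i l ↦ Real.log (l.2 i))
    fun i ↦ ((measurable_pi_apply i).comp measurable_snd).log

theorem GPrime_prod_dirac (F : SeparatedIFSFamily K 𝒜) (Q : Measure 𝒜) [IsProbabilityMeasure Q]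
    (p : Fin K → ℝ) (θ : ℝ) : F.GPrime (Q.prod (Measure.dirac p)) θ =
      (∫ u, Real.log (p (F.mPrime θ (u, p))) ∂Q) /
        ∫ u, Real.log (F.a (F.mPrime θ (u, p)) u) ∂Q := by
  rw [GPrime, Measure.prod_dirac,
    integral_map measurable_prodMk_right.aemeasurable
      (F.measurable_log_weight_mPrime θ).aestronglyMeasurable,
    integral_map measurable_prodMk_right.aemeasurable
      (F.measurable_log_a_mPrime θ).aestronglyMeasurable]

theorem integrable_log_a_mPrime (F : SeparatedIFSFamily K 𝒜) (Q : Measure 𝒜)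
    [IsProbabilityMeasure Q] (p : Fin K → ℝ) (θ : ℝ) :
    Integrable (fun u ↦ Real.log (F.a (F.mPrime θ (u, p)) u)) Q :=
  .of_bound ((F.measurable_log_a_mPrime θ).comp measurable_prodMk_right).aestronglyMeasurable _
    (.of_forall fun u ↦ F.abs_log_a_le _ u)

theorem integrable_log_weight_mPrime (F : SeparatedIFSFamily K 𝒜) (Q : Measure 𝒜)
    [IsProbabilityMeasure Q] {p : Fin K → ℝ} (hp : p ∈ validWeights K) (θ : ℝ) :
    Integrable (fun u ↦ Real.log (p (F.mPrime θ (u, p)))) Q := by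
  have h := ((F.integrable_log_a_mPrime Q p θ).const_mul θ).sub (F.integrable_logCost Q hp θ)
  refine h.congr (.of_forall fun u ↦ ?_)
  simp [F.logCost_eq_mPrime hp.1]

theorem integral_log_a_mPrime_neg (F : SeparatedIFSFamily K 𝒜) (Q : Measure 𝒜)
    [IsProbabilityMeasure Q] (p : Fin K → ℝ) (θ : ℝ) :
    ∫ u, Real.log (F.a (F.mPrime θ (u, p)) u) ∂Q < 0 :=
  calc ∫ u, Real.log (F.a (F.mPrime θ (u, p)) u) ∂Q ≤ ∫ _u, Real.log F.B ∂Q :=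
        integral_mono (F.integrable_log_a_mPrime Q p θ) (integrable_const _)
          fun u ↦ F.log_a_le _ u
    _ = Real.log F.B := by simp
    _ < 0 := F.log_B_neg

theorem GPrime_nonneg (F : SeparatedIFSFamily K 𝒜) (Q : Measure 𝒜) [IsProbabilityMeasure Q]
    {p : Fin K → ℝ} (hp : p ∈ validWeights K) (θ : ℝ) :
    0 ≤ F.GPrime (Q.prod (Measure.dirac p)) θ := by
  rw [F.GPrime_prod_dirac]
  exact div_nonneg_of_nonpos
    (integral_nonpos fun u ↦ Real.log_nonpos (hp.1 _).le (validWeights.le_one hp _))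
    (F.integral_log_a_mPrime_neg Q p θ).le

/-- The expected cost lies below the line given by the selection `m'(θ, ·)`. -/
theorem meanCost_le (F : SeparatedIFSFamily K 𝒜) (Q : Measure 𝒜) [IsProbabilityMeasure Q]
    {p : Fin K → ℝ} (hp : p ∈ validWeights K) (θ t : ℝ) :
    F.meanCost Q p t ≤ t * (∫ u, Real.log (F.a (F.mPrime θ (u, p)) u) ∂Q) -
      ∫ u, Real.log (p (F.mPrime θ (u, p))) ∂Q := by
  have h1 := (F.integrable_log_a_mPrime Q p θ).const_mul t
  have h2 := F.integrable_log_weight_mPrime Q hp θ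
  rw [← integral_const_mul, ← integral_sub h1 h2]
  exact integral_mono (F.integrable_logCost Q hp t) (h1.sub h2) fun u ↦ F.logCost_le p t u _

theorem meanCost_eq (F : SeparatedIFSFamily K 𝒜) (Q : Measure 𝒜) [IsProbabilityMeasure Q]
    {p : Fin K → ℝ} (hp : p ∈ validWeights K) (t : ℝ) :
    F.meanCost Q p t = t * (∫ u, Real.log (F.a (F.mPrime t (u, p)) u) ∂Q) -
      ∫ u, Real.log (p (F.mPrime t (u, p))) ∂Q := by
  rw [← integral_const_mul, ← integral_sub ((F.integrable_log_a_mPrime Q p t).const_mul t)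
    (F.integrable_log_weight_mPrime Q hp t)]
  exact integral_congr_ae (.of_forall fun u ↦ F.logCost_eq_mPrime hp.1 t u)

theorem le_MPrime_iff (F : SeparatedIFSFamily K 𝒜) (Q : Measure 𝒜) [IsProbabilityMeasure Q]
    {p : Fin K → ℝ} (hp : p ∈ validWeights K) {t : ℝ} (ht : 0 ≤ t) :
    t ≤ F.MPrime Q p ↔ 0 ≤ F.meanCost Q p t := by
  constructor
  · intro h
    have hle : F.MPrime Q p ≤ F.GPrime (Q.prod (Measure.dirac p)) t :=
      ciInf_le (f := fun θ : Set.Ici (0 : ℝ) ↦ F.GPrime (Q.prod (Measure.dirac p)) θ)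
        ⟨0, by rintro _ ⟨θ, rfl⟩; exact F.GPrime_nonneg Q hp θ⟩ ⟨t, ht⟩
    have h' := h.trans hle
    rw [F.GPrime_prod_dirac, le_div_iff_of_neg (F.integral_log_a_mPrime_neg Q p t)] at h'
    rw [F.meanCost_eq Q hp]
    linarith
  · intro h
    have : Nonempty (Set.Ici (0 : ℝ)) := ⟨⟨0, Set.self_mem_Ici⟩⟩
    refine le_ciInf fun θ ↦ ?_
    rw [F.GPrime_prod_dirac, le_div_iff_of_neg (F.integral_log_a_mPrime_neg Q p θ)]
    linarith [F.meanCost_le Q hp θ t]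

theorem MPrime_mem_Icc (F : SeparatedIFSFamily K 𝒜) (Q : Measure 𝒜) [IsProbabilityMeasure Q]
    {p : Fin K → ℝ} (hp : p ∈ validWeights K) : F.MPrime Q p ∈ Set.Icc (0 : ℝ) 1 := by
  refine ⟨(F.le_MPrime_iff Q hp le_rfl).2 (F.meanCost_zero_nonneg Q hp), ?_⟩
  by_contra! h
  exact ((F.le_MPrime_iff Q hp zero_le_one).1 h.le).not_gt (F.meanCost_one_neg Q hp)

/-- The floor `A / K` is low enough for `exists_floorWeights`, since `K A ≤ B < 1`. -/
theorem natCast_mul_floor_le (F : SeparatedIFSFamily K 𝒜) : (K : ℝ) * (F.A / K) ≤ 1 / K := by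
  have hK : (0 : ℝ) < K := by exact_mod_cast Nat.pos_of_ne_zero (NeZero.ne K)
  rw [mul_div_cancel₀ _ hK.ne', le_div_iff₀ hK]
  linarith [F.K_mul_A_le, F.B_lt_one]

/-- The pairs `(p,t)` of a weight vector with all weights at least `A / K` and some `t ∈ [0,1]`
which is at most `M'(p)`, expressed through the expected cost. -/
def flooredHypograph (F : SeparatedIFSFamily K 𝒜) (Q : Measure 𝒜) : Set ((Fin K → ℝ) × ℝ) :=
  {x | x ∈ Set.Icc (fun _ ↦ F.A / K) (fun _ ↦ 1) ×ˢ Set.Icc 0 1 ∧ ∑ i, x.1 i = 1 ∧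
    0 ≤ F.meanCost Q x.1 x.2}

theorem isCompact_flooredHypograph (F : SeparatedIFSFamily K 𝒜) (Q : Measure 𝒜)
    [IsProbabilityMeasure Q] : IsCompact (F.flooredHypograph Q) := by
  have hK : (0 : ℝ) < K := by exact_mod_cast Nat.pos_of_ne_zero (NeZero.ne K)
  have hbox : IsCompact (Set.Icc (fun _ : Fin K ↦ F.A / K) (fun _ ↦ 1) ×ˢ Set.Icc (0 : ℝ) 1) :=
    isCompact_Icc.prod isCompact_Icc
  have hcl := (F.continuousOn_meanCost Q (div_pos F.A_pos hK)).preimage_isClosed_of_isClosed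
    hbox.isClosed isClosed_Ici (t := Set.Ici 0)
  have hsum : IsClosed {x : (Fin K → ℝ) × ℝ | ∑ i, x.1 i = 1} :=
    isClosed_eq (by fun_prop) continuous_const
  refine hbox.of_isClosed_subset ?_ fun x hx ↦ hx.1
  convert hcl.inter hsum using 1
  ext x
  simp only [flooredHypograph, Set.mem_ofPred_eq, Set.mem_inter_iff, Set.mem_preimage, Set.mem_Ici]
  tauto

theorem mem_validWeights_of_mem_flooredHypograph (F : SeparatedIFSFamily K 𝒜) {Q : Measure 𝒜}
    {x : (Fin K → ℝ) × ℝ} (hx : x ∈ F.flooredHypograph Q) : x.1 ∈ validWeights K :=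
  have hK : (0 : ℝ) < K := by exact_mod_cast Nat.pos_of_ne_zero (NeZero.ne K)
  ⟨fun i ↦ (div_pos F.A_pos hK).trans_le (hx.1.1.1 i), hx.2.1⟩

theorem exists_mem_flooredHypograph (F : SeparatedIFSFamily K 𝒜) (Q : Measure 𝒜)
    [IsProbabilityMeasure Q] {p : Fin K → ℝ} (hp : p ∈ validWeights K) :
    ∃ q, (q, F.MPrime Q p) ∈ F.flooredHypograph Q := by
  have hK : (0 : ℝ) < K := by exact_mod_cast Nat.pos_of_ne_zero (NeZero.ne K)
  have hε := div_pos F.A_pos hK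
  have hM := F.MPrime_mem_Icc Q hp
  obtain ⟨q, hεq, hq1, hqp, k, hk⟩ := exists_floorWeights hp hε F.natCast_mul_floor_le
  have hq : q ∈ validWeights K := ⟨fun i ↦ hε.trans_le (hεq i), hq1⟩
  refine ⟨q, ⟨⟨hεq, validWeights.le_one hq⟩, hM⟩, hq1, ?_⟩
  exact ((F.le_MPrime_iff Q hp hM.1).1 le_rfl).trans <|
    integral_mono (F.integrable_logCost Q hp _) (F.integrable_logCost Q hq _)
      (F.logCost_mono_of_le_max hM hq.1 hk hqp)

end SeparatedIFSFamily

/-! ### Existence of an optimal weight vector -/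

theorem mainTheorem11 {K : ℕ} [NeZero K] (hK : 2 ≤ K) {𝒜 : Type*} [MeasurableSpace 𝒜]
    (Q : Measure 𝒜) [IsProbabilityMeasure Q] (F : SeparatedIFSFamily K 𝒜) :
    ∃ q ∈ validWeights K, IsLUB (F.MPrime Q '' validWeights K) (F.MPrime Q q) := by
  have hunif : (fun _ ↦ 1 / (K : ℝ)) ∈ validWeights K := by
    have : (0 : ℝ) < K := by exact_mod_cast Nat.pos_of_ne_zero (NeZero.ne K)
    exact ⟨fun _ ↦ by positivity, by simp [this.ne']⟩
  obtain ⟨q₀, hq₀⟩ := F.exists_mem_flooredHypograph Q hunif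
  obtain ⟨⟨q, T⟩, hqT, hmax⟩ := (F.isCompact_flooredHypograph Q).exists_isMaxOn ⟨_, hq₀⟩
    continuousOn_snd
  have hq : q ∈ validWeights K := F.mem_validWeights_of_mem_flooredHypograph hqT
  refine ⟨q, hq, IsGreatest.isLUB ⟨⟨q, hq, rfl⟩, ?_⟩⟩
  rintro _ ⟨p, hp, rfl⟩
  obtain ⟨p', hp'⟩ := F.exists_mem_flooredHypograph Q hp
  exact (hmax hp').trans ((F.le_MPrime_iff Q hq hqT.1.2.1).2 hqT.2.2)
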